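/- Let $X$ be a real or complex Banach space and $\mathcal L(X)$ the space of bounded linear operators on $X$. For $S:[0,\infty)\to\mathcal L(X)$ let $S'(0)$ be the linear operator $S'(0)\psi=\lim_{h\to 0+}h^{-1}(S(h)\psi-S(0)\psi)$ (norm limit), whose domain $D(S'(0))$ is the set of all $\psi\in X$ for which this limit exists. Let $\mathcal F_X$ be the set of all $F:[0,\infty)\to\mathcal L(X)$ such that $F(0)=I$, $D(F'(0))$ is dense in $X$, and for some $M\ge 1$, $a\in\mathbb R$ one has $\|F(s/n)^m\|\le M\exp\left(\frac{am}{n}s\right)$ for all integers $n,m\ge 1$ and all $s\ge 0$. A $C_0$-semigroup is a strongly continuous map $S:[0,\infty)\to\mathcal L(X)$ with $S(0)=I$, $S(s+t)=S(s)S(t)$ for all $s,t\ge0$, and $\|S(s)\|\le M\exp(as)$ for all $s\ge 0$, for some $M>1$, $a\in\mathbb R$; its generator is $S'(0)$. **Theorem.** Let $F\in\mathcal F_X$, and let $Z$ be a linear operator in $X$ with domain $D(Z)\subseteq D(F'(0))$ and $Zf=F'(0)f$ for all $f\in D(Z)$. (Such a $Z$ is always closable; $\overline Z$ denotes its closure.)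 Assume that $A\subseteq D(Z)$ is a linear subspace that is dense in $X$, and that there is a fixed $l>0$ such that for each $f_0\in A$ there is a function $f:[0,l)\to D(\overline Z)$, differentiable in norm (one-sidedly at $0$), with $$f'(s)=\overline Z f(s)\quad (s\in[0,l)),\qquad f(0)=f_0 .$$ Then $Z$ is closable and $\overline Z$ is the generator of a $C_0$-semigroup $S$. Furthermore, $$S(t)f=\lim_{n\to\infty}F(t/n)^n f\qquad\text{(in norm) for all } t\ge 0 \text{ and all } f\in X .$$ -/

import Mathlib

open Filter Topology
open scoped NNReal

/-- `y` is the strong derivative at `0` of `S : [0, ∞) → 𝓛(E)` in the direction `ψ`: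
`y = lim_{h → 0, h > 0} h⁻¹ (S(h) ψ - S(0) ψ)`, a limit in norm. -/
def IsStrongDerivZeroAt {𝕜 E : Type*} [RCLike 𝕜] [NormedAddCommGroup E] [NormedSpace 𝕜 E]
    (S : ℝ≥0 → E →L[𝕜] E) (ψ y : E) : Prop :=
  Tendsto (fun h : ℝ≥0 => (((h : ℝ) : 𝕜))⁻¹ • (S h ψ - S 0 ψ)) (𝓝[≠] 0) (𝓝 y)

namespace IsStrongDerivZeroAt

variable {𝕜 E : Type*} [RCLike 𝕜] [NormedAddCommGroup E] [NormedSpace 𝕜 E]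
  {S : ℝ≥0 → E →L[𝕜] E} {ψ ψ' y y' : E}

theorem unique (h : IsStrongDerivZeroAt S ψ y) (h' : IsStrongDerivZeroAt S ψ y') : y = y' :=
  tendsto_nhds_unique h h'

theorem zero : IsStrongDerivZeroAt S 0 0 := by
  simp [IsStrongDerivZeroAt]

theorem add (h : IsStrongDerivZeroAt S ψ y) (h' : IsStrongDerivZeroAt S ψ' y') :
    IsStrongDerivZeroAt S (ψ + ψ') (y + y') := by
  refine (Tendsto.add h h').congr fun r => ?_
  rw [← smul_add, map_add, map_add, add_sub_add_comm]

theorem smul (c : 𝕜) (h : IsStrongDerivZeroAt S ψ y) :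
    IsStrongDerivZeroAt S (c • ψ) (c • y) := by
  refine (Tendsto.const_smul h c).congr fun r => ?_
  rw [map_smul, map_smul, ← smul_sub, smul_comm]

end IsStrongDerivZeroAt

/-- The strong derivative `S'(0)` of `S : [0, ∞) → 𝓛(E)`, an (in general unbounded) linear
operator whose domain is the space of all `ψ` for which the limit
`lim_{h → 0} h⁻¹ (S(h) ψ - S(0) ψ)` exists. -/
noncomputable def strongDerivZero {𝕜 E : Type*} [RCLike 𝕜] [NormedAddCommGroup E]
    [NormedSpace 𝕜 E] (S : ℝ≥0 → E →L[𝕜] E) : E →ₗ.[𝕜] E where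
  domain :=
    { carrier := {ψ | ∃ y, IsStrongDerivZeroAt S ψ y}
      add_mem' := by
        rintro _ _ ⟨y, hy⟩ ⟨y', hy'⟩
        exact ⟨y + y', hy.add hy'⟩
      zero_mem' := ⟨0, IsStrongDerivZeroAt.zero⟩
      smul_mem' := by
        rintro c _ ⟨y, hy⟩
        exact ⟨c • y, hy.smul c⟩ }
  toFun :=
    { toFun := fun ψ => Classical.choose ψ.2
      map_add' := fun ψ ψ' =>
        (Classical.choose_spec (ψ + ψ').2).unique
          ((Classical.choose_spec ψ.2).add (Classical.choose_spec ψ'.2))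
      map_smul' := fun c ψ =>
        (Classical.choose_spec (c • ψ).2).unique ((Classical.choose_spec ψ.2).smul c) }

/-- The domain and the values of `S'(0)` are the intended ones. -/
theorem mem_graph_strongDerivZero_iff {𝕜 E : Type*} [RCLike 𝕜] [NormedAddCommGroup E]
    [NormedSpace 𝕜 E] {S : ℝ≥0 → E →L[𝕜] E} {ψ y : E} :
    (ψ, y) ∈ (strongDerivZero S).graph ↔ IsStrongDerivZeroAt S ψ y := by
  rw [LinearPMap.mem_graph_iff]
  constructor
  · rintro ⟨x, rfl, rfl⟩
    exact Classical.choose_spec x.2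
  · intro h
    have hx : ∃ y, IsStrongDerivZeroAt S ψ y := ⟨y, h⟩
    exact ⟨⟨ψ, hx⟩, rfl, (Classical.choose_spec hx).unique h⟩

/-- The class `𝓕^E_{M,a}` of functions `F : [0, ∞) → 𝓛(E)` with `F(0) = I`,
`‖F(s/n)^m‖ ≤ M exp((a m / n) s)` for all natural `n, m ≥ 1` and `s ≥ 0`, and with the domain of
`F'(0)` dense in `E`. -/
structure IsChernoffFunctionWith {𝕜 E : Type*} [RCLike 𝕜] [NormedAddCommGroup E]
    [NormedSpace 𝕜 E] (M a : ℝ) (F : ℝ≥0 → E →L[𝕜] E) : Prop where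
  map_zero : F 0 = 1
  norm_pow_le : ∀ n m : ℕ, 1 ≤ n → 1 ≤ m → ∀ s : ℝ≥0,
    ‖F (s / n) ^ m‖ ≤ M * Real.exp (a * m / n * s)
  dense_domain : Dense ((strongDerivZero F).domain : Set E)

/-- The class `𝓕_E`, the union of the classes `𝓕^E_{M,a}` over `M ≥ 1` and `a ∈ ℝ`. -/
def IsChernoffFunction {𝕜 E : Type*} [RCLike 𝕜] [NormedAddCommGroup E]
    [NormedSpace 𝕜 E] (F : ℝ≥0 → E →L[𝕜] E) : Prop :=
  ∃ M a : ℝ, 1 ≤ M ∧ IsChernoffFunctionWith M a F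

/-- `T : [0, ∞) → 𝓛(E)` is a `C₀`-semigroup: a strongly continuous, exponentially bounded
one-parameter semigroup of bounded operators. -/
structure IsC0Semigroup {𝕜 E : Type*} [RCLike 𝕜] [NormedAddCommGroup E]
    [NormedSpace 𝕜 E] (T : ℝ≥0 → E →L[𝕜] E) : Prop where
  map_zero : T 0 = 1
  map_add : ∀ s t : ℝ≥0, T (s + t) = T s * T t
  continuous : ∀ x : E, Continuous fun s => T s x
  norm_le : ∃ M a : ℝ, 1 < M ∧ ∀ s : ℝ≥0, ‖T s‖ ≤ M * Real.exp (a * s)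

/-- The operator `Z` is the generator of the `C₀`-semigroup `T`: it is the strong derivative of `T`
at `0`, with equality of domains. -/
def IsGeneratorOf {𝕜 E : Type*} [RCLike 𝕜] [NormedAddCommGroup E]
    [NormedSpace 𝕜 E] (Z : E →ₗ.[𝕜] E) (T : ℝ≥0 → E →L[𝕜] E) : Prop :=
  IsC0Semigroup T ∧ Z = strongDerivZero T

/-- `f : [0, l) → 𝓓(B)` is a solution of `f'(s) = B f(s)`, `s ∈ [0, l)`, `f(0) = f₀`. The derivative
is the norm derivative in `E` (one-sided at `s = 0`). Only the values of `f` on `[0, l)` matter. -/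
def IsLocalSolution {𝕜 E : Type*} [RCLike 𝕜] [NormedAddCommGroup E] [NormedSpace 𝕜 E]
    [NormedSpace ℝ E] (B : E →ₗ.[𝕜] E) (l : ℝ) (f₀ : E) (f : ℝ → E) : Prop :=
  f 0 = f₀ ∧ ∀ s ∈ Set.Ico 0 l, ∃ hs : f s ∈ B.domain,
    HasDerivWithinAt f (B ⟨f s, hs⟩) (Set.Ico 0 l) s

/-! Solutions attract the discrete evolution. If `u` solves the equation on `[0, T]`, let the curve
follow `u` up to time `t` and then make the remaining steps of size `h`. First-order consistency
with the closure of `F'(0)` makes this family almost stationary as `h → 0`, so its two ends, `u T`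
and `F(h)^⌊T/h⌋ (u 0)`, have the same limit (`IsStable.discreteTendsto_of_hasDerivWithinAt`).
Stability extends convergence from `A` to `X`, composition extends it to all times, and the limit is
a semigroup `S`.

Let `Γ` be the closure of the graph of `Z`. Consistency puts `Γ` inside the graph of `S'(0)`.
Conversely, for `g ∈ A` the orbit is the given solution, so `(S(s)g, S(s)Zg)` stays in `Γ` and so
does its time average, whose second entry is a difference quotient. Averages are continuous in `g`,
hence lie in `Γ` for every vector; letting the time tend to `0` gives the graph of `S'(0)`. Thus `Γ`
is a graph, which yields closability as well. -/

/-! ### A mean value argument along a filter -/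

/-- The limsup of the distance to the starting point is a function of `t` with zero derivative,
hence constant. Taking the limsup first means that the threshold on `i` may depend on `s`, so no
uniformity is needed. -/
theorem tendsto_sub_zero_of_locally_small {ι X : Type*} [NormedAddCommGroup X]
    {𝓕 : Filter ι} [𝓕.NeBot] {a : ι → ℝ → X} {T : ℝ} (hT : 0 ≤ T)
    (hbdd : ∀ t ∈ Set.Icc 0 T, ∃ C : ℝ, ∀ᶠ i in 𝓕, ‖a i t - a i 0‖ ≤ C)
    (hloc : ∀ t ∈ Set.Icc 0 T, ∀ ε > 0, ∀ᶠ s in 𝓝[Set.Icc 0 T] t,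
      ∀ᶠ i in 𝓕, ‖a i s - a i t‖ ≤ ε * |s - t|) :
    Tendsto (fun i => a i T - a i 0) 𝓕 (𝓝 0) := by
  set φ : ℝ → ENNReal := fun t => limsup (fun i => edist (a i t) (a i 0)) 𝓕 with hφ
  have hfin : ∀ t ∈ Set.Icc 0 T, φ t ≠ ⊤ := by
    intro t ht
    obtain ⟨C, hC⟩ := hbdd t ht
    refine ne_top_of_le_ne_top ENNReal.ofReal_ne_top (b := ENNReal.ofReal C) ?_
    refine limsup_le_of_le (by isBoundedDefault) ?_
    filter_upwards [hC] with i hi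
    rw [edist_dist, dist_eq_norm]
    exact ENNReal.ofReal_le_ofReal hi
  have htri : ∀ s t : ℝ, ∀ η : ℝ, 0 ≤ η → (∀ᶠ i in 𝓕, ‖a i s - a i t‖ ≤ η) →
      φ s ≤ ENNReal.ofReal η + φ t := by
    intro s t η hη h
    calc φ s ≤ limsup (fun i => ENNReal.ofReal η + edist (a i t) (a i 0)) 𝓕 := by
          refine limsup_le_limsup ?_ (by isBoundedDefault) (by isBoundedDefault)
          filter_upwards [h] with i hi
          refine (edist_triangle _ (a i t) _).trans ?_
          gcongr
          rw [edist_dist, dist_eq_norm]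
          exact ENNReal.ofReal_le_ofReal hi
      _ ≤ _ := by
          refine (limsup_const_add 𝓕 _ _ ?_ ?_).le
          · isBoundedDefault
          · isBoundedDefault
  have hreal : ∀ s ∈ Set.Icc 0 T, ∀ t ∈ Set.Icc 0 T, ∀ η : ℝ, 0 ≤ η →
      (∀ᶠ i in 𝓕, ‖a i s - a i t‖ ≤ η) → (φ s).toReal - (φ t).toReal ≤ η := by
    intro s hs t ht η hη h
    have h1 := htri s t η hη h
    have h2 := ENNReal.toReal_mono (by finiteness [hfin t ht]) h1
    rw [ENNReal.toReal_add (by finiteness) (hfin t ht), ENNReal.toReal_ofReal hη] at h2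
    linarith
  have hderiv : ∀ t ∈ Set.Icc 0 T,
      HasDerivWithinAt (fun s => (φ s).toReal) 0 (Set.Icc 0 T) t := by
    intro t ht
    rw [hasDerivWithinAt_iff_isLittleO, Asymptotics.isLittleO_iff]
    intro ε hε
    filter_upwards [hloc t ht ε hε, self_mem_nhdsWithin] with s hs hsT
    have hnn : 0 ≤ ε * |s - t| := by positivity
    have h1 := hreal s hsT t ht _ hnn hs
    have h2 := hreal t ht s hsT _ hnn (by simpa only [norm_sub_rev] using hs)
    rw [smul_zero, sub_zero, Real.norm_eq_abs, Real.norm_eq_abs, abs_le]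
    constructor <;> linarith
  have hconst := constant_of_derivWithin_zero
    (fun t ht => (hderiv t ht).differentiableWithinAt)
    (fun t ht => (hderiv t (Set.Ico_subset_Icc_self ht)).derivWithin
      (uniqueDiffOn_Icc (lt_of_le_of_lt ht.1 ht.2) t (Set.Ico_subset_Icc_self ht)))
    T ⟨hT, le_rfl⟩
  have h0 : φ 0 = 0 := by
    refine le_antisymm ?_ zero_le
    simp only [hφ, edist_self]
    exact limsup_le_of_le (by isBoundedDefault) (Eventually.of_forall fun _ => le_rfl)
  -- `toReal` also vanishes at `⊤`, which the boundedness hypothesis excludes.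
  have hT0 : φ T = 0 := by
    have : (φ T).toReal = 0 := by simpa [h0] using hconst
    rcases (ENNReal.toReal_eq_zero_iff _).1 this with h | h
    · exact h
    · exact absurd h (hfin T ⟨hT, le_rfl⟩)
  have hlim : Tendsto (fun i => edist (a i T) (a i 0)) 𝓕 (𝓝 0) :=
    tendsto_of_le_liminf_of_limsup_le zero_le hT0.le
  rw [tendsto_iff_edist_tendsto_0]
  simpa [edist_eq_enorm_sub] using hlim

/-! ### Stability and consistency of the powers of `F(h)` -/

section Discrete
variable {𝕜 X : Type*} [RCLike 𝕜] [NormedAddCommGroup X] [NormedSpace 𝕜 X]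

theorem ContinuousLinearMap.pow_apply_sub_eq_sum (T : X →L[𝕜] X) (k : ℕ) (x : X) :
    (T ^ k) x - x = ∑ i ∈ Finset.range k, (T ^ i) (T x - x) := by
  have := Finset.sum_range_sub (fun i => (T ^ i) x) k
  simp only [pow_zero, one_apply_eq_self] at this
  rw [← this]
  refine Finset.sum_congr rfl fun i _ => ?_
  rw [map_sub, pow_succ, mul_apply_eq_comp]

/-- Stability of `F`: the powers `F(h)^m` are bounded as long as `m h` stays bounded. -/
def IsStable (F : ℝ≥0 → X →L[𝕜] X) : Prop :=
  ∀ K : ℝ, ∃ C : ℝ, 1 ≤ C ∧ ∀ (h : ℝ≥0) (m : ℕ), (m : ℝ) * h ≤ K → ‖F h ^ m‖ ≤ C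

theorem IsChernoffFunctionWith.norm_pow_le' {M a : ℝ} {F : ℝ≥0 → X →L[𝕜] X}
    (hM : 1 ≤ M) (hF : IsChernoffFunctionWith M a F) (h : ℝ≥0) (m : ℕ) :
    ‖F h ^ m‖ ≤ M * Real.exp (a * m * h) := by
  rcases Nat.eq_zero_or_pos m with rfl | hm
  · simp only [pow_zero, Nat.cast_zero, mul_zero, zero_mul, Real.exp_zero, mul_one]
    exact (ContinuousLinearMap.norm_id_le).trans hM
  · simpa using hF.norm_pow_le 1 m le_rfl hm h

theorem IsChernoffFunctionWith.isStable {M a : ℝ} {F : ℝ≥0 → X →L[𝕜] X}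
    (hM : 1 ≤ M) (hF : IsChernoffFunctionWith M a F) : IsStable F := by
  intro K
  refine ⟨M * Real.exp (|a| * |K|), ?_, fun h m hmh => (hF.norm_pow_le' hM h m).trans ?_⟩
  · exact one_le_mul_of_one_le_of_one_le hM (Real.one_le_exp (by positivity))
  · have h1 : a * m * h ≤ |a| * |K| := by
      rw [mul_assoc]
      have h0 : 0 ≤ (m : ℝ) * h := by positivity
      exact (mul_le_mul_of_nonneg_right (le_abs_self a) h0).trans
        (mul_le_mul_of_nonneg_left (hmh.trans (le_abs_self K)) (abs_nonneg a))
    gcongr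

theorem ContinuousLinearMap.norm_apply_le_of_le {T : X →L[𝕜] X} {C η : ℝ} {x : X}
    (hT : ‖T‖ ≤ C) (hx : ‖x‖ ≤ η) : ‖T x‖ ≤ C * η :=
  (T.le_opNorm x).trans (mul_le_mul hT hx (norm_nonneg _) ((norm_nonneg _).trans hT))

theorem IsStrongDerivZeroAt.eventually_norm_le {F : ℝ≥0 → X →L[𝕜] X} (h0 : F 0 = 1)
    {y z : X} (hy : IsStrongDerivZeroAt F y z) {ε : ℝ} (hε : 0 < ε) :
    ∀ᶠ h : ℝ≥0 in 𝓝[≠] 0, ‖F h y - y - ((h : ℝ) : 𝕜) • z‖ ≤ h * ε := by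
  filter_upwards [hy (Metric.closedBall_mem_nhds z hε), self_mem_nhdsWithin] with h hh hne
  have hne' : ((h : ℝ) : 𝕜) ≠ 0 := by
    simpa using hne
  have : F h y - y - ((h : ℝ) : 𝕜) • z =
      ((h : ℝ) : 𝕜) • ((((h : ℝ) : 𝕜))⁻¹ • (F h y - F 0 y) - z) := by
    rw [smul_sub, smul_inv_smul₀ hne', h0, one_apply_eq_self]
  rw [this, norm_smul, RCLike.norm_ofReal, abs_of_nonneg h.coe_nonneg]
  rw [Set.mem_preimage, mem_closedBall_iff_norm] at hh
  gcongr

theorem eventually_coe_le {δ : ℝ} (hδ : 0 < δ) : ∀ᶠ h : ℝ≥0 in 𝓝[≠] 0, (h : ℝ) ≤ δ := by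
  have : Tendsto (fun h : ℝ≥0 => (h : ℝ)) (𝓝[≠] 0) (𝓝 0) :=
    (NNReal.continuous_coe.tendsto' 0 0 rfl).mono_left nhdsWithin_le_nhds
  exact this.eventually_le_const hδ

/-- The orbits `k h ↦ F(h)^k f` are equicontinuous at time zero as `h → 0`. -/
theorem IsStable.eventually_pow_sub_le {F : ℝ≥0 → X →L[𝕜] X} (hF : IsStable F) (h0 : F 0 = 1)
    (hd : Dense ((strongDerivZero F).domain : Set X)) (f : X) {ε : ℝ} (hε : 0 < ε) :
    ∃ δ > 0, ∀ᶠ h : ℝ≥0 in 𝓝[≠] 0, ∀ k : ℕ, (k : ℝ) * h ≤ δ → ‖(F h ^ k) f - f‖ ≤ ε := by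
  obtain ⟨C, hC1, hC⟩ := hF 1
  have hCpos : 0 < C := by linarith
  obtain ⟨y, ⟨z, hz⟩, hyf⟩ := hd.exists_dist_lt f (show 0 < ε / (2 * (C + 1)) by positivity)
  rw [dist_eq_norm] at hyf
  -- The bound `1` keeps `C` available; the other makes the telescoped sum for `y` at most `ε / 2`.
  refine ⟨min 1 (ε / (2 * (C * (‖z‖ + 1)))), by positivity, ?_⟩
  filter_upwards [hz.eventually_norm_le h0 one_pos] with h hh k hk
  have hk1 : (k : ℝ) * h ≤ 1 := hk.trans (min_le_left _ _)
  have hstep : ‖F h y - y‖ ≤ h * (‖z‖ + 1) := by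
    have h1 : ‖((h : ℝ) : 𝕜) • z‖ = h * ‖z‖ := by
      rw [norm_smul, RCLike.norm_ofReal, abs_of_nonneg h.coe_nonneg]
    have := norm_le_norm_add_norm_sub' (F h y - y) (((h : ℝ) : 𝕜) • z)
    linarith
  have hy2 : ‖(F h ^ k) y - y‖ ≤ ε / 2 := by
    rw [ContinuousLinearMap.pow_apply_sub_eq_sum]
    calc ‖∑ i ∈ Finset.range k, (F h ^ i) (F h y - y)‖
        ≤ ∑ i ∈ Finset.range k, C * (h * (‖z‖ + 1)) := by
          refine norm_sum_le_of_le _ fun i hi => ?_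
          refine ContinuousLinearMap.norm_apply_le_of_le (hC h i (le_trans ?_ hk1)) hstep
          have : (i : ℝ) ≤ k := by exact_mod_cast (Finset.mem_range.1 hi).le
          gcongr
      _ = (k * h) * (C * (‖z‖ + 1)) := by simp; ring
      _ ≤ ε / (2 * (C * (‖z‖ + 1))) * (C * (‖z‖ + 1)) := by
          gcongr
          exact hk.trans (min_le_right _ _)
      _ = ε / 2 := by field_simp
  have hdiff : ‖(F h ^ k) (f - y)‖ ≤ C * (ε / (2 * (C + 1))) :=
    ContinuousLinearMap.norm_apply_le_of_le (hC h k hk1) hyf.le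
  have heq : (F h ^ k) f - f = (F h ^ k) (f - y) + ((F h ^ k) y - y) - (f - y) := by
    rw [map_sub]; abel
  have hsum : C * (ε / (2 * (C + 1))) + ε / (2 * (C + 1)) = ε / 2 := by field_simp
  rw [heq]
  have h1 := norm_sub_le ((F h ^ k) (f - y) + ((F h ^ k) y - y)) (f - y)
  have h2 := norm_add_le ((F h ^ k) (f - y)) ((F h ^ k) y - y)
  linarith

/-- First-order consistency of the discrete orbits with the closure of `F'(0)`. -/
theorem IsStable.eventually_pow_sub_sub_le {F : ℝ≥0 → X →L[𝕜] X} (hF : IsStable F)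
    (h0 : F 0 = 1) (hd : Dense ((strongDerivZero F).domain : Set X)) {x w : X}
    (hxw : (x, w) ∈ closure ((strongDerivZero F).graph : Set (X × X))) {ε : ℝ} (hε : 0 < ε) :
    ∃ δ > 0, ∀ r > 0, ∀ᶠ h : ℝ≥0 in 𝓝[≠] 0, ∀ k : ℕ, (k : ℝ) * h ≤ δ →
      ‖(F h ^ k) x - x - ((((k : ℝ) * h : ℝ)) : 𝕜) • w‖ ≤ ε * (k * h + r) := by
  obtain ⟨C, hC1, hC⟩ := hF 1
  have hCpos : 0 < C := by linarith
  obtain ⟨δ₀, hδ₀, hw⟩ := hF.eventually_pow_sub_le h0 hd w (half_pos hε)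
  refine ⟨min 1 δ₀, by positivity, fun r hr => ?_⟩
  -- The approximant may depend on `r`, whereas `δ` was fixed by `w` alone. Replacing `x` by `y`
  -- costs `(C + 1)‖x - y‖ ≤ ε r`.
  obtain ⟨⟨y, z⟩, hyz, hdist⟩ := Metric.mem_closure_iff.1 hxw
    (min (ε * r / (C + 1)) (ε / (4 * C))) (by positivity)
  rw [SetLike.mem_coe, mem_graph_strongDerivZero_iff] at hyz
  rw [Prod.dist_eq, max_lt_iff, dist_eq_norm, dist_eq_norm] at hdist
  have hxy : ‖x - y‖ ≤ ε * r / (C + 1) := hdist.1.le.trans (min_le_left _ _)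
  have hwz : ‖w - z‖ ≤ ε / (4 * C) := hdist.2.le.trans (min_le_right _ _)
  filter_upwards [hw, hyz.eventually_norm_le h0 (show 0 < ε / (4 * C) by positivity)]
    with h hwh hyh k hk
  have hk1 : (k : ℝ) * h ≤ 1 := hk.trans (min_le_left _ _)
  have hik : ∀ i ∈ Finset.range k, (i : ℝ) * h ≤ k * h := fun i hi => by
    have : (i : ℝ) ≤ k := by exact_mod_cast (Finset.mem_range.1 hi).le
    gcongr
  have hterm : ∀ i ∈ Finset.range k,
      ‖(F h ^ i) (F h y - y) - ((h : ℝ) : 𝕜) • w‖ ≤ h * ε := by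
    intro i hi
    have h1 : ‖(F h ^ i) (F h y - y - ((h : ℝ) : 𝕜) • z)‖ ≤ C * (h * (ε / (4 * C))) :=
      ContinuousLinearMap.norm_apply_le_of_le (hC h i ((hik i hi).trans hk1)) hyh
    have h2 : ‖(F h ^ i) (w - z)‖ ≤ C * (ε / (4 * C)) :=
      ContinuousLinearMap.norm_apply_le_of_le (hC h i ((hik i hi).trans hk1)) hwz
    have h3 := hwh i ((hik i hi).trans (hk.trans (min_le_right _ _)))
    -- Per unit of `h`, the errors are `ε/4` for consistency at `y`, `ε/2` for the drift of `w`, and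
    -- `ε/4` for `w - z`.
    have heq : (F h ^ i) (F h y - y) - ((h : ℝ) : 𝕜) • w =
        (F h ^ i) (F h y - y - ((h : ℝ) : 𝕜) • z) +
          ((h : ℝ) : 𝕜) • (((F h ^ i) w - w) - (F h ^ i) (w - z)) := by
      simp only [map_sub, map_smul, smul_sub]; abel
    rw [heq]
    refine (norm_add_le _ _).trans ?_
    rw [norm_smul, RCLike.norm_ofReal, abs_of_nonneg h.coe_nonneg]
    have h4 : ‖((F h ^ i) w - w) - (F h ^ i) (w - z)‖ ≤ ε / 2 + C * (ε / (4 * C)) :=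
      (norm_sub_le _ _).trans (add_le_add h3 h2)
    have h5 : C * (ε / (4 * C)) = ε / 4 := by field_simp
    have h6 : C * (h * (ε / (4 * C))) = h * (ε / 4) := by field_simp
    rw [h5] at h4
    rw [h6] at h1
    have h7 := mul_le_mul_of_nonneg_left h4 h.coe_nonneg
    linarith
  have hy2 : ‖(F h ^ k) y - y - ((((k : ℝ) * h : ℝ)) : 𝕜) • w‖ ≤ k * (h * ε) := by
    have heq : (F h ^ k) y - y - ((((k : ℝ) * h : ℝ)) : 𝕜) • w =
        ∑ i ∈ Finset.range k, ((F h ^ i) (F h y - y) - ((h : ℝ) : 𝕜) • w) := by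
      rw [ContinuousLinearMap.pow_apply_sub_eq_sum, Finset.sum_sub_distrib, Finset.sum_const,
        Finset.card_range, ← Nat.cast_smul_eq_nsmul 𝕜, smul_smul]
      push_cast
      rfl
    rw [heq]
    refine (norm_sum_le_of_le _ hterm).trans (le_of_eq ?_)
    simp
  have hdiff : ‖(F h ^ k) (x - y)‖ ≤ C * (ε * r / (C + 1)) :=
    ContinuousLinearMap.norm_apply_le_of_le (hC h k hk1) hxy
  have heq : (F h ^ k) x - x - ((((k : ℝ) * h : ℝ)) : 𝕜) • w =
      (F h ^ k) (x - y) + ((F h ^ k) y - y - ((((k : ℝ) * h : ℝ)) : 𝕜) • w) - (x - y) := by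
    rw [map_sub]; abel
  have hsum : C * (ε * r / (C + 1)) + ε * r / (C + 1) = ε * r := by field_simp
  rw [heq]
  have h1 := norm_sub_le
    ((F h ^ k) (x - y) + ((F h ^ k) y - y - ((((k : ℝ) * h : ℝ)) : 𝕜) • w)) (x - y)
  have h2 := norm_add_le ((F h ^ k) (x - y)) ((F h ^ k) y - y - ((((k : ℝ) * h : ℝ)) : 𝕜) • w)
  linarith

/-- Rounding `r` to a multiple of `h` is harmless: with `h ≤ r` one has `k h ≤ 2 r`, so the previous
estimate at `ε/4` costs `3/4` of the budget and the rounding error the rest. -/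
theorem IsStable.eventually_pow_sub_sub_le' {F : ℝ≥0 → X →L[𝕜] X} (hF : IsStable F)
    (h0 : F 0 = 1) (hd : Dense ((strongDerivZero F).domain : Set X)) {x w : X}
    (hxw : (x, w) ∈ closure ((strongDerivZero F).graph : Set (X × X))) {ε : ℝ} (hε : 0 < ε) :
    ∃ δ > 0, ∀ r > 0, r < δ → ∀ᶠ h : ℝ≥0 in 𝓝[≠] 0, ∀ k : ℕ, |(k : ℝ) * h - r| ≤ h →
      ‖(F h ^ k) x - x - ((r : ℝ) : 𝕜) • w‖ ≤ ε * r := by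
  obtain ⟨δ, hδ, H⟩ := hF.eventually_pow_sub_sub_le h0 hd hxw (show 0 < ε / 4 by positivity)
  refine ⟨δ / 2, by positivity, fun r hr hrδ => ?_⟩
  filter_upwards [H r hr, eventually_coe_le hr,
    eventually_coe_le (show 0 < ε / 4 * r / (‖w‖ + 1) by positivity)] with h hh h1 h2 k hk
  obtain ⟨hk1, hk2⟩ := abs_le.1 hk
  have h3 := hh k (by linarith)
  have h4 : ‖((((k : ℝ) * h - r : ℝ)) : 𝕜) • w‖ ≤ ε / 4 * r := by
    rw [norm_smul, RCLike.norm_ofReal]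
    calc |(k : ℝ) * h - r| * ‖w‖ ≤ ε / 4 * r / (‖w‖ + 1) * (‖w‖ + 1) := by
          gcongr
          · exact hk.trans h2
          · linarith
      _ = ε / 4 * r := by field_simp
  have heq : (F h ^ k) x - x - ((r : ℝ) : 𝕜) • w =
      ((F h ^ k) x - x - ((((k : ℝ) * h : ℝ)) : 𝕜) • w) +
        ((((k : ℝ) * h - r : ℝ)) : 𝕜) • w := by
    push_cast
    rw [sub_smul]; abel
  rw [heq]
  refine (norm_add_le _ _).trans ?_
  nlinarith

end Discrete

/-! ### Counting time steps -/

theorem floor_div_mul_le {T : ℝ} (hT : 0 ≤ T) (h : ℝ≥0) : (⌊T / h⌋₊ : ℝ) * h ≤ T := by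
  rcases eq_or_ne h 0 with rfl | hne
  · simpa using hT
  · have hpos : (0 : ℝ) < h := by positivity
    exact (le_div_iff₀ hpos).1 (Nat.floor_le (by positivity))

theorem floor_div_sub_floor_div_mul_le {s t : ℝ} (hs : 0 ≤ s) (hst : s ≤ t) {h : ℝ≥0}
    (hne : h ≠ 0) : |((⌊t / h⌋₊ - ⌊s / h⌋₊ : ℕ) : ℝ) * h - (t - s)| ≤ h := by
  have hpos : (0 : ℝ) < h := by positivity
  have ht : 0 ≤ t := hs.trans hst
  have hle : ⌊s / (h : ℝ)⌋₊ ≤ ⌊t / (h : ℝ)⌋₊ := Nat.floor_mono (by gcongr)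
  rw [Nat.cast_sub hle]
  have h1 := floor_div_mul_le hs h
  have h2 := floor_div_mul_le ht h
  have h3 : s < (⌊s / (h : ℝ)⌋₊ + 1) * h := (div_lt_iff₀ hpos).1 (Nat.lt_floor_add_one _)
  have h4 : t < (⌊t / (h : ℝ)⌋₊ + 1) * h := (div_lt_iff₀ hpos).1 (Nat.lt_floor_add_one _)
  rw [abs_le]
  constructor <;> nlinarith

/-! ### Convergence of the discrete evolution and the limit semigroup -/

section Convergence
variable {𝕜 X : Type*} [RCLike 𝕜] [NormedAddCommGroup X] [NormedSpace 𝕜 X]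

/-- The discrete evolution `F(h)^⌊t/h⌋ f` converges to `g` as `h → 0`. -/
def DiscreteTendsto (F : ℝ≥0 → X →L[𝕜] X) (t : ℝ) (f g : X) : Prop :=
  Tendsto (fun h : ℝ≥0 => (F h ^ ⌊t / (h : ℝ)⌋₊) f) (𝓝[≠] 0) (𝓝 g)

/-- Pointwise differentiability suffices, with no continuity of `w`, because the mean value argument
is local at each `t`. -/
theorem IsStable.discreteTendsto_of_hasDerivWithinAt [NormedSpace ℝ X] [IsScalarTower ℝ 𝕜 X]
    {F : ℝ≥0 → X →L[𝕜] X} (hF : IsStable F)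
    (h0 : F 0 = 1) (hd : Dense ((strongDerivZero F).domain : Set X)) {T : ℝ} (hT : 0 ≤ T)
    {u w : ℝ → X}
    (hu : ∀ t ∈ Set.Icc 0 T, HasDerivWithinAt u (w t) (Set.Icc 0 T) t)
    (hw : ∀ t ∈ Set.Icc 0 T,
      (u t, w t) ∈ closure ((strongDerivZero F).graph : Set (X × X))) :
    DiscreteTendsto F T (u 0) (u T) := by
  obtain ⟨C, hC1, hC⟩ := hF T
  have hN : ∀ (h : ℝ≥0) (k : ℕ), k ≤ ⌊T / (h : ℝ)⌋₊ → ‖F h ^ k‖ ≤ C := by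
    intro h k hk
    refine hC h k (le_trans ?_ (floor_div_mul_le hT h))
    have : (k : ℝ) ≤ (⌊T / (h : ℝ)⌋₊ : ℝ) := by exact_mod_cast hk
    gcongr
  have hmono : ∀ (h : ℝ≥0) {s t : ℝ}, s ≤ t → ⌊s / (h : ℝ)⌋₊ ≤ ⌊t / (h : ℝ)⌋₊ :=
    fun h s t hst => Nat.floor_mono (by gcongr)
  -- The interpolating curve: `u` up to time `t`, then the remaining discrete steps.
  set a : ℝ≥0 → ℝ → X := fun h t => (F h ^ (⌊T / (h : ℝ)⌋₊ - ⌊t / (h : ℝ)⌋₊)) (u t) with ha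
  have hdiff : ∀ (h : ℝ≥0) {s t : ℝ}, s ≤ t → t ≤ T → a h t - a h s =
      (F h ^ (⌊T / (h : ℝ)⌋₊ - ⌊t / (h : ℝ)⌋₊))
        (u t - (F h ^ (⌊t / (h : ℝ)⌋₊ - ⌊s / (h : ℝ)⌋₊)) (u s)) := by
    intro h s t hst htT
    have e : ⌊T / (h : ℝ)⌋₊ - ⌊s / (h : ℝ)⌋₊ = (⌊T / (h : ℝ)⌋₊ - ⌊t / (h : ℝ)⌋₊) +
        (⌊t / (h : ℝ)⌋₊ - ⌊s / (h : ℝ)⌋₊) := by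
      have := hmono h hst
      have := hmono h htT
      omega
    simp only [ha]
    rw [e, pow_add, mul_apply_eq_comp, map_sub]
  have key : Tendsto (fun h => a h T - a h 0) (𝓝[≠] 0) (𝓝 0) := by
    refine tendsto_sub_zero_of_locally_small hT ?_ ?_
    · refine fun t ht => ⟨C * ‖u t‖ + C * ‖u 0‖, Eventually.of_forall fun h => ?_⟩
      refine (norm_sub_le _ _).trans (add_le_add ?_ ?_) <;>
      exact ContinuousLinearMap.norm_apply_le_of_le (hN h _ (Nat.sub_le _ _)) le_rfl
    · intro t ht ε hε
      have hCpos : 0 < C := by linarith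
      -- Each local defect is at most `(2 + C) η |s - t|`, and the remaining steps multiply it by at
      -- most `C`.
      set η := ε / (C * (2 + C)) with hη
      have hηpos : 0 < η := by positivity
      have hηle : C * (2 + C) * η ≤ ε := by rw [hη]; field_simp; exact le_rfl
      obtain ⟨δ₁, hδ₁, H1⟩ := hF.eventually_pow_sub_sub_le' h0 hd (hw t ht) hηpos
      obtain ⟨δ₂, hδ₂, H2⟩ := hF.eventually_pow_sub_le h0 hd (w t) hηpos
      have hder := (Asymptotics.isLittleO_iff.1
        (hasDerivWithinAt_iff_isLittleO.1 (hu t ht))) hηpos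
      have hball : Metric.ball t (min δ₁ (δ₂ / 2)) ∈ 𝓝[Set.Icc 0 T] t :=
        mem_nhdsWithin_of_mem_nhds (Metric.ball_mem_nhds t (by positivity))
      filter_upwards [hder, hball, self_mem_nhdsWithin] with s hs hsb hsT
      rw [Metric.mem_ball, Real.dist_eq, lt_min_iff] at hsb
      rw [RCLike.real_smul_eq_coe_smul (K := 𝕜), Real.norm_eq_abs] at hs
      rcases lt_trichotomy s t with hst | rfl | hst
      · have hr : 0 < t - s := by linarith
        have habs : |s - t| = t - s := by rw [abs_sub_comm]; exact abs_of_pos hr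
        rw [habs] at hsb hs ⊢
        filter_upwards [H1 (t - s) hr hsb.1, H2,
          eventually_coe_le (half_pos hδ₂), self_mem_nhdsWithin] with h h1 h2 h3 hne
        set k := ⌊t / (h : ℝ)⌋₊ - ⌊s / (h : ℝ)⌋₊ with hk
        have hkr : |(k : ℝ) * h - (t - s)| ≤ h :=
          floor_div_sub_floor_div_mul_le hsT.1 hst.le hne
        have h4 := h1 k hkr
        have h5 := h2 k (by have := (abs_le.1 hkr).2; linarith)
        rw [← norm_neg, neg_sub, hdiff h hst.le ht.2]
        have h6 : ‖(F h ^ k) (u s - u t - ((s - t : ℝ) : 𝕜) • w t)‖ ≤ C * (η * (t - s)) :=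
          ContinuousLinearMap.norm_apply_le_of_le
            (hN h k ((Nat.sub_le _ _).trans (hmono h ht.2))) hs
        -- The derivative is known only at the later time `t`, so `u s` is expanded about `t`; this
        -- requires `F(h)^k` to move `w t` little.
        have heq : u t - (F h ^ k) (u s) =
            ((t - s : ℝ) : 𝕜) • ((F h ^ k) (w t) - w t)
            - ((F h ^ k) (u t) - u t - ((t - s : ℝ) : 𝕜) • w t)
            - (F h ^ k) (u s - u t - ((s - t : ℝ) : 𝕜) • w t) := by
          have e : ((s - t : ℝ) : 𝕜) = -((t - s : ℝ) : 𝕜) := by push_cast; ring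
          rw [e]
          simp only [map_sub, map_smul, smul_sub, neg_smul, map_neg]
          abel
        have h7 : ‖u t - (F h ^ k) (u s)‖ ≤ (2 + C) * η * (t - s) := by
          rw [heq]
          refine (norm_sub_le _ _).trans ((add_le_add (norm_sub_le _ _) h6).trans ?_)
          rw [norm_smul, RCLike.norm_ofReal, abs_of_pos hr]
          nlinarith
        refine (ContinuousLinearMap.norm_apply_le_of_le (hN h _ (Nat.sub_le _ _)) h7).trans ?_
        nlinarith
      · simp
      · have hr : 0 < s - t := by linarith
        have habs : |s - t| = s - t := abs_of_pos hr
        rw [habs] at hsb hs ⊢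
        filter_upwards [H1 (s - t) hr hsb.1, self_mem_nhdsWithin] with h h1 hne
        set k := ⌊s / (h : ℝ)⌋₊ - ⌊t / (h : ℝ)⌋₊ with hk
        have h4 := h1 k (floor_div_sub_floor_div_mul_le ht.1 hst.le hne)
        rw [hdiff h hst.le hsT.2]
        have h7 : ‖u s - (F h ^ k) (u t)‖ ≤ (2 + C) * η * (s - t) := by
          have heq : u s - (F h ^ k) (u t) = (u s - u t - ((s - t : ℝ) : 𝕜) • w t) -
            ((F h ^ k) (u t) - u t - ((s - t : ℝ) : 𝕜) • w t) := by abel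
          rw [heq]
          have h8 : 0 ≤ C * η * (s - t) := by positivity
          refine (norm_sub_le _ _).trans ((add_le_add hs h4).trans ?_)
          linarith
        refine (ContinuousLinearMap.norm_apply_le_of_le (hN h _ (Nat.sub_le _ _)) h7).trans ?_
        nlinarith
  have := (key.const_sub (u T))
  simpa [ha, DiscreteTendsto] using this

namespace IsStable
variable {F : ℝ≥0 → X →L[𝕜] X}

theorem norm_discrete_le (hF : IsStable F) {t : ℝ} (ht : 0 ≤ t) :
    ∃ C : ℝ, 1 ≤ C ∧ ∀ h : ℝ≥0, ‖F h ^ ⌊t / (h : ℝ)⌋₊‖ ≤ C := by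
  obtain ⟨C, hC1, hC⟩ := hF t
  exact ⟨C, hC1, fun h => hC h _ (floor_div_mul_le ht h)⟩

/-- The evolutions are uniformly bounded in `h`, so the Cauchy property passes to limits of vectors.
-/
theorem isClosed_setOf_discreteTendsto [CompleteSpace X] (hF : IsStable F) {t : ℝ}
    (ht : 0 ≤ t) : IsClosed {f | ∃ g, DiscreteTendsto F t f g} := by
  obtain ⟨C, hC1, hC⟩ := hF.norm_discrete_le ht
  refine isClosed_of_closure_subset fun f hf => ?_
  refine cauchy_map_iff_exists_tendsto.1 (Metric.cauchy_iff.2 ⟨inferInstance, fun ε hε => ?_⟩)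
  obtain ⟨y, ⟨g, hg⟩, hfy⟩ := Metric.mem_closure_iff.1 hf (ε / (4 * C)) (by positivity)
  rw [dist_eq_norm] at hfy
  refine ⟨Metric.ball g (ε / 2), ?_, ?_⟩
  · rw [mem_map]
    filter_upwards [Filter.mem_map.1 (hg (Metric.ball_mem_nhds g (show 0 < ε / 4 by positivity)))] with h hh
    rw [Set.mem_preimage, mem_ball_iff_norm] at *
    have h1 := ContinuousLinearMap.norm_apply_le_of_le (hC h) hfy.le
    have h2 : C * (ε / (4 * C)) = ε / 4 := by field_simp
    rw [map_sub, h2] at h1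
    have h3 := norm_sub_le_norm_sub_add_norm_sub ((F h ^ ⌊t / (h : ℝ)⌋₊) f)
      ((F h ^ ⌊t / (h : ℝ)⌋₊) y) g
    linarith
  · intro x hx y hy
    have := dist_triangle_right x y g
    rw [Metric.mem_ball] at hx hy
    linarith

/-- One additional step is negligible, since `F(h) f → f` and the preceding powers are bounded. -/
theorem pow_congr_of_close (hF : IsStable F) (h0 : F 0 = 1)
    (hd : Dense ((strongDerivZero F).domain : Set X)) {t : ℝ} {f g : X} (m n : ℝ≥0 → ℕ)
    (hm : ∀ᶠ h : ℝ≥0 in 𝓝[≠] 0, (m h : ℝ) * h ≤ t)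
    (hmn : ∀ᶠ h in 𝓝[≠] 0, m h = n h ∨ n h = m h + 1)
    (hg : Tendsto (fun h => (F h ^ m h) f) (𝓝[≠] 0) (𝓝 g)) :
    Tendsto (fun h => (F h ^ n h) f) (𝓝[≠] 0) (𝓝 g) := by
  obtain ⟨C, hC1, hC⟩ := hF t
  have hz : Tendsto (fun h => (F h ^ n h) f - (F h ^ m h) f) (𝓝[≠] 0) (𝓝 0) := by
    rw [Metric.tendsto_nhds]
    intro ε hε
    obtain ⟨δ, hδ, H⟩ := hF.eventually_pow_sub_le h0 hd f
      (show 0 < ε / (2 * C) by positivity)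
    filter_upwards [H, hm, hmn, eventually_coe_le hδ] with h h1 h2 h3 h4
    rw [dist_zero_right]
    rcases h3 with h3 | h3
    · simpa [h3] using hε
    · have h5 := h1 1 (by simpa using h4)
      have h6 := ContinuousLinearMap.norm_apply_le_of_le (hC h (m h) h2) h5
      have h7 : C * (ε / (2 * C)) = ε / 2 := by field_simp
      rw [h3, pow_add, mul_apply_eq_comp, ← map_sub]
      linarith
  simpa using hg.add hz

theorem discreteTendsto_add (hF : IsStable F) (h0 : F 0 = 1)
    (hd : Dense ((strongDerivZero F).domain : Set X)) {s t : ℝ} (hs : 0 ≤ s) (ht : 0 ≤ t)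
    {f g k : X} (hf : DiscreteTendsto F t f g) (hg : DiscreteTendsto F s g k) :
    DiscreteTendsto F (s + t) f k := by
  obtain ⟨C, hC1, hC⟩ := hF.norm_discrete_le hs
  refine hF.pow_congr_of_close h0 hd (t := s + t)
    (fun h => ⌊s / (h : ℝ)⌋₊ + ⌊t / (h : ℝ)⌋₊) _ ?_ ?_ ?_
  · refine Eventually.of_forall fun h => ?_
    push_cast
    rw [add_mul]
    exact add_le_add (floor_div_mul_le hs h) (floor_div_mul_le ht h)
  -- The floor of a sum exceeds the sum of the floors by at most one.
  · refine Eventually.of_forall fun h => ?_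
    have hs' : 0 ≤ s / (h : ℝ) := by positivity
    have ht' : 0 ≤ t / (h : ℝ) := by positivity
    have h1 : ⌊s / (h : ℝ)⌋₊ + ⌊t / (h : ℝ)⌋₊ ≤ ⌊s / (h : ℝ) + t / (h : ℝ)⌋₊ := by
      refine Nat.le_floor ?_
      push_cast
      exact add_le_add (Nat.floor_le hs') (Nat.floor_le ht')
    have h2 : ⌊s / (h : ℝ) + t / (h : ℝ)⌋₊ < ⌊s / (h : ℝ)⌋₊ + ⌊t / (h : ℝ)⌋₊ + 2 := by
      refine (Nat.floor_lt (by positivity)).2 ?_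
      push_cast
      linarith [Nat.lt_floor_add_one (s / (h : ℝ)), Nat.lt_floor_add_one (t / (h : ℝ))]
    rw [add_div]
    omega
  · have hz : Tendsto (fun h : ℝ≥0 => (F h ^ ⌊s / (h : ℝ)⌋₊) ((F h ^ ⌊t / (h : ℝ)⌋₊) f - g))
        (𝓝[≠] 0) (𝓝 0) := by
      refine squeeze_zero_norm
        (fun h => ContinuousLinearMap.norm_apply_le_of_le (hC h) le_rfl) ?_
      simpa using (hf.sub_const g).norm.const_mul C
    have := hz.add hg
    simp only [zero_add, map_sub, sub_add_cancel] at this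
    simpa only [pow_add, mul_apply_eq_comp] using this

theorem discreteTendsto_zero (f : X) : DiscreteTendsto F 0 f f := by
  simp [DiscreteTendsto]

theorem exists_discreteTendsto (hF : IsStable F) (h0 : F 0 = 1)
    (hd : Dense ((strongDerivZero F).domain : Set X)) {l : ℝ} (hl : 0 < l)
    (H : ∀ t, 0 ≤ t → t < l → ∀ f, ∃ g, DiscreteTendsto F t f g) {t : ℝ} (ht : 0 ≤ t) (f : X) :
    ∃ g, DiscreteTendsto F t f g := by
  obtain ⟨n, hn⟩ := exists_nat_gt (t / l)
  have hn0 : (0 : ℝ) < n := lt_of_le_of_lt (by positivity) hn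
  have hstep : ∀ m : ℕ, ∃ g, DiscreteTendsto F (m * (t / n)) f g := by
    intro m
    induction m with
    | zero => exact ⟨f, by simpa using discreteTendsto_zero f⟩
    | succ m ih =>
      obtain ⟨g, hg⟩ := ih
      obtain ⟨k, hk⟩ := H (t / n) (by positivity)
        (by rw [div_lt_iff₀ hn0]; rwa [div_lt_iff₀ hl, mul_comm] at hn) g
      refine ⟨k, ?_⟩
      have := hF.discreteTendsto_add h0 hd (by positivity) (by positivity) hg hk
      have e : ((m + 1 : ℕ) : ℝ) * (t / n) = t / n + m * (t / n) := by push_cast; ring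
      rwa [e]
  have := hstep n
  rwa [mul_div_cancel₀ t hn0.ne'] at this

end IsStable

/-- For `t ≠ 0`, the step `h = t / n` with `n ≥ 1` makes `⌊t / h⌋` exactly `n`. -/
theorem DiscreteTendsto.tendsto_pow {F : ℝ≥0 → X →L[𝕜] X} (h0 : F 0 = 1) {t : ℝ≥0} {f g : X}
    (hg : DiscreteTendsto F t f g) :
    Tendsto (fun n : ℕ => (F (t / n) ^ n) f) atTop (𝓝 g) := by
  rcases eq_or_ne t 0 with rfl | ht
  · have : f = g := tendsto_nhds_unique
      (by simp) hg
    simp [h0, this]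
  · have hlim : Tendsto (fun n : ℕ => t / (n : ℝ≥0)) atTop (𝓝[≠] 0) := by
      refine tendsto_nhdsWithin_iff.2 ⟨NNReal.tendsto_coe.1 ?_, ?_⟩
      · simpa using tendsto_const_div_atTop_nhds_zero_nat (t : ℝ)
      filter_upwards [eventually_gt_atTop 0] with n hn
      have : (n : ℝ≥0) ≠ 0 := by exact_mod_cast hn.ne'
      exact div_ne_zero ht this
    refine (hg.comp hlim).congr' ?_
    filter_upwards [eventually_gt_atTop 0] with n hn
    have hn' : (n : ℝ) ≠ 0 := by exact_mod_cast hn.ne'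
    have ht' : (t : ℝ) ≠ 0 := by exact_mod_cast ht
    have : (t : ℝ) / ((t / n : ℝ≥0) : ℝ) = n := by
      push_cast
      field_simp
    simp only [Function.comp_apply]
    rw [this, Nat.floor_natCast]

/-- The strong limit of the discrete evolutions is an exponentially bounded `C₀`-semigroup. -/
theorem IsChernoffFunctionWith.exists_isC0Semigroup {M a : ℝ} {F : ℝ≥0 → X →L[𝕜] X}
    (hM : 1 ≤ M) (hF : IsChernoffFunctionWith M a F)
    (H : ∀ t : ℝ≥0, ∀ f, ∃ g, DiscreteTendsto F t f g) :
    ∃ S : ℝ≥0 → X →L[𝕜] X, IsC0Semigroup S ∧ ∀ (t : ℝ≥0) f, DiscreteTendsto F t f (S t f) := by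
  have hst := hF.isStable hM
  have h0 := hF.map_zero
  have hd := hF.dense_domain
  choose G hG using H
  have hlin : ∀ t : ℝ≥0, ∃ S : X →ₗ[𝕜] X, ∀ f, S f = G t f := fun t =>
    ⟨{ toFun := G t
       map_add' := fun x y => tendsto_nhds_unique (hG t (x + y))
        (((hG t x).add (hG t y)).congr fun h => (map_add _ _ _).symm)
       map_smul' := fun c x => tendsto_nhds_unique (hG t (c • x))
        (((hG t x).const_smul c).congr fun h => (map_smul _ _ _).symm) }, fun _ => rfl⟩
  choose S₀ hS₀ using hlin
  have hbd : ∀ t f, ‖S₀ t f‖ ≤ M * Real.exp (a * t) * ‖f‖ := by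
    intro t f
    rw [hS₀]
    refine le_of_tendsto ((hG t f).tendsto_pow h0).norm ?_
    filter_upwards [eventually_gt_atTop 0] with n hn
    refine ContinuousLinearMap.norm_apply_le_of_le ((hF.norm_pow_le n n hn hn t).trans ?_) le_rfl
    have : (n : ℝ) ≠ 0 := by exact_mod_cast hn.ne'
    rw [mul_div_cancel_right₀ _ this]
  set S : ℝ≥0 → X →L[𝕜] X := fun t => (S₀ t).mkContinuous _ (hbd t) with hSdef
  have hS : ∀ (t : ℝ≥0) f, DiscreteTendsto F t f (S t f) := fun t f => by
    simpa [hSdef, hS₀] using hG t f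
  have hSn : ∀ t : ℝ≥0, ‖S t‖ ≤ M * Real.exp (a * t) := fun t =>
    LinearMap.mkContinuous_norm_le _ (by positivity) _
  have hadd : ∀ s t : ℝ≥0, S (s + t) = S s * S t := by
    intro s t
    ext f
    refine tendsto_nhds_unique (hS (s + t) f) ?_
    have := hst.discreteTendsto_add h0 hd s.coe_nonneg t.coe_nonneg (hS t f) (hS s (S t f))
    simpa [DiscreteTendsto] using this
  have hsmall : ∀ f, ∀ ε > 0, ∃ δ > 0, ∀ t : ℝ≥0, (t : ℝ) ≤ δ → ‖S t f - f‖ ≤ ε := by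
    intro f ε hε
    obtain ⟨δ, hδ, h⟩ := hst.eventually_pow_sub_le h0 hd f hε
    refine ⟨δ, hδ, fun t ht => le_of_tendsto ((hS t f).sub_const f).norm ?_⟩
    filter_upwards [h] with k hk
    exact hk _ ((floor_div_mul_le t.coe_nonneg k).trans ht)
  -- `M + 1` because a semigroup bound is required to have constant strictly above `1`.
  refine ⟨S, ⟨?_, hadd, ?_, M + 1, a, by linarith, fun t => (hSn t).trans ?_⟩, hS⟩
  · ext f
    exact tendsto_nhds_unique (hS 0 f) (by simp)
  · intro f
    rw [Metric.continuous_iff]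
    intro t ε hε
    set C := M * Real.exp (|a| * (t + 1)) with hCdef
    have hCpos : 0 < C := by positivity
    have hC : ∀ s : ℝ≥0, (s : ℝ) ≤ t + 1 → ‖S s‖ ≤ C := by
      intro s hs
      refine (hSn s).trans ?_
      have : a * s ≤ |a| * (t + 1) :=
        (mul_le_mul_of_nonneg_right (le_abs_self a) s.coe_nonneg).trans
          (mul_le_mul_of_nonneg_left hs (abs_nonneg a))
      rw [hCdef]
      gcongr
    obtain ⟨δ, hδ, h⟩ := hsmall f (ε / (2 * C)) (by positivity)
    have hC2 : C * (ε / (2 * C)) < ε := by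
      have : C * (ε / (2 * C)) = ε / 2 := by field_simp
      linarith
    -- Factoring out `S` at the earlier time reduces left and right continuity to continuity at `0`.
    have hstep : ∀ s r : ℝ≥0, (s : ℝ) ≤ t + 1 → s ≤ r → (r : ℝ) - s ≤ δ →
        ‖S r f - S s f‖ < ε := by
      intro s r hs hsr hδr
      obtain ⟨d, rfl⟩ := exists_add_of_le hsr
      rw [hadd, mul_apply_eq_comp, ← map_sub]
      refine lt_of_le_of_lt (ContinuousLinearMap.norm_apply_le_of_le (hC s hs) (h d ?_)) hC2
      push_cast at hδr
      linarith
    refine ⟨min δ 1, by positivity, fun s hs => ?_⟩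
    rw [NNReal.dist_eq, lt_min_iff, abs_lt, abs_lt] at hs
    rw [dist_eq_norm]
    rcases le_total s t with hle | hle
    · rw [norm_sub_rev]
      exact hstep s t (by linarith) hle (by linarith)
    · exact hstep t s (by linarith) hle (by linarith)
  · gcongr
    linarith

end Convergence

/-! ### Identification of the generator -/

section Generator
variable {𝕜 X : Type*} [RCLike 𝕜] [NormedAddCommGroup X] [NormedSpace 𝕜 X]

/-- The generator of the limit semigroup extends the closure of `F'(0)`. -/
theorem IsStable.isStrongDerivZeroAt_of_mem_closure {F : ℝ≥0 → X →L[𝕜] X} (hF : IsStable F)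
    (h0 : F 0 = 1) (hd : Dense ((strongDerivZero F).domain : Set X)) {S : ℝ≥0 → X →L[𝕜] X}
    (hS0 : S 0 = 1) (hS : ∀ (t : ℝ≥0) f, DiscreteTendsto F t f (S t f)) {x w : X}
    (hxw : (x, w) ∈ closure ((strongDerivZero F).graph : Set (X × X))) :
    IsStrongDerivZeroAt S x w := by
  rw [IsStrongDerivZeroAt, Metric.tendsto_nhds]
  intro ε hε
  obtain ⟨δ, hδ, H⟩ := hF.eventually_pow_sub_sub_le' h0 hd hxw (half_pos hε)
  filter_upwards [eventually_coe_le (half_pos hδ), self_mem_nhdsWithin] with r hrδ hr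
  have hr' : r ≠ 0 := hr
  have hrpos : (0 : ℝ) < r := by positivity
  have hrne : ((r : ℝ) : 𝕜) ≠ 0 := by simpa using hr'
  -- Here `r` is fixed and `h → 0` in the consistency estimate.
  have hb : ‖S r x - x - ((r : ℝ) : 𝕜) • w‖ ≤ ε / 2 * r := by
    refine le_of_tendsto (((hS r x).sub_const x).sub_const _).norm ?_
    filter_upwards [H r hrpos (by linarith), self_mem_nhdsWithin] with h hh hne
    refine hh _ ?_
    simpa using floor_div_sub_floor_div_mul_le le_rfl hrpos.le hne
  have heq : ((r : ℝ) : 𝕜)⁻¹ • (S r x - S 0 x) - w =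
      ((r : ℝ) : 𝕜)⁻¹ • (S r x - x - ((r : ℝ) : 𝕜) • w) := by
    rw [hS0, one_apply_eq_self, smul_sub _ (S r x - x), inv_smul_smul₀ hrne]
  rw [dist_eq_norm, heq, norm_smul, norm_inv, RCLike.norm_ofReal, abs_of_pos hrpos]
  calc (r : ℝ)⁻¹ * ‖S r x - x - ((r : ℝ) : 𝕜) • w‖ ≤ (r : ℝ)⁻¹ * (ε / 2 * r) := by gcongr
    _ = ε / 2 := by field_simp
    _ < ε := half_lt_self hε

theorem IsC0Semigroup.isStrongDerivZeroAt_apply {S : ℝ≥0 → X →L[𝕜] X} (hS : IsC0Semigroup S)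
    {x w : X} (hx : IsStrongDerivZeroAt S x w) (s : ℝ≥0) :
    IsStrongDerivZeroAt S (S s x) (S s w) := by
  refine (((S s).continuous.tendsto w).comp hx).congr fun h => ?_
  have hc : S h (S s x) = S s (S h x) := by
    rw [← mul_apply_eq_comp, ← hS.map_add, add_comm, hS.map_add, mul_apply_eq_comp]
  simp [hc, hS.map_zero]

variable [NormedSpace ℝ X]

/-- Both entries depend continuously on `x`, so membership can be checked on a dense set. -/
theorem IsC0Semigroup.isClosed_setOf_average_mem [CompleteSpace X] {S : ℝ≥0 → X →L[𝕜] X}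
    (hS : IsC0Semigroup S) {Γ : Submodule 𝕜 (X × X)} (hΓ : IsClosed (Γ : Set (X × X)))
    {τ : ℝ} (hτ : 0 ≤ τ) : IsClosed {x |
      (τ⁻¹ • ∫ s in (0 : ℝ)..τ, S s.toNNReal x, τ⁻¹ • (S τ.toNNReal x - x)) ∈ Γ} := by
  obtain ⟨M, a, hM, hb⟩ := hS.norm_le
  have hcont : ∀ y : X, Continuous fun s : ℝ => S s.toNNReal y := fun y =>
    (hS.continuous y).comp continuous_real_toNNReal
  have hlip : LipschitzWith (Real.toNNReal (M * Real.exp (|a| * τ) * |τ - 0|))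
      fun x => ∫ s in (0 : ℝ)..τ, S s.toNNReal x := by
    refine LipschitzWith.of_dist_le_mul fun x y => ?_
    rw [dist_eq_norm, ← intervalIntegral.integral_sub ((hcont x).intervalIntegrable 0 τ)
      ((hcont y).intervalIntegrable 0 τ), Real.coe_toNNReal _ (by positivity), mul_right_comm]
    refine intervalIntegral.norm_integral_le_of_norm_le_const fun s hs => ?_
    rw [Set.uIoc_of_le hτ] at hs
    rw [← map_sub, dist_eq_norm]
    refine ContinuousLinearMap.norm_apply_le_of_le ((hb _).trans ?_) le_rfl
    rw [Real.coe_toNNReal _ hs.1.le]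
    have : a * s ≤ |a| * τ := (mul_le_mul_of_nonneg_right (le_abs_self a) hs.1.le).trans
      (mul_le_mul_of_nonneg_left hs.2 (abs_nonneg a))
    gcongr
  refine hΓ.preimage ?_
  refine (hlip.continuous.const_smul _).prodMk (Continuous.const_smul ?_ _)
  exact (S τ.toNNReal).continuous.sub continuous_id

variable [IsScalarTower ℝ 𝕜 X]

/-- A closed subspace is closed and convex, hence contains averages of curves lying in it; the
fundamental theorem of calculus evaluates the second entry. -/
theorem IsC0Semigroup.average_mem [CompleteSpace X] {S : ℝ≥0 → X →L[𝕜] X}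
    (hS : IsC0Semigroup S) {Γ : Submodule 𝕜 (X × X)} (hΓ : IsClosed (Γ : Set (X × X)))
    {τ : ℝ} (hτ : 0 < τ) {x w : X} (hxw : ∀ s ∈ Set.Icc 0 τ,
      (S s.toNNReal x, S s.toNNReal w) ∈ Γ)
    (hder : ∀ s ∈ Set.Ioo 0 τ, HasDerivAt (fun s : ℝ => S s.toNNReal x) (S s.toNNReal w) s) :
    (τ⁻¹ • ∫ s in (0 : ℝ)..τ, S s.toNNReal x, τ⁻¹ • (S τ.toNNReal x - x)) ∈ Γ := by
  have hcont : ∀ y : X, Continuous fun s : ℝ => S s.toNNReal y := fun y =>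
    (hS.continuous y).comp continuous_real_toNNReal
  have hint : ∫ s in (0 : ℝ)..τ, S s.toNNReal w = S τ.toNNReal x - x := by
    have := intervalIntegral.integral_eq_sub_of_hasDerivAt_of_le hτ.le
      (hcont x).continuousOn hder ((hcont w).intervalIntegrable 0 τ)
    simpa [hS.map_zero] using this
  have hconv : Convex ℝ (Γ : Set (X × X)) := (Γ.restrictScalars ℝ).convex
  have hintg : ∀ y : X, MeasureTheory.IntegrableOn (fun s : ℝ => S s.toNNReal y)
      (Set.Ioc 0 τ) := fun y => ((hcont y).intervalIntegrable 0 τ).1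
  have hmem := hconv.set_average_mem (μ := MeasureTheory.volume) (t := Set.Ioc 0 τ)
    (f := fun s : ℝ => (S s.toNNReal x, S s.toNNReal w)) hΓ (by simpa using hτ) (by simp)
    ((MeasureTheory.ae_restrict_iff' measurableSet_Ioc).2
      (Eventually.of_forall fun s hs => hxw s (Set.Ioc_subset_Icc_self hs)))
    ((hintg x).prodMk (hintg w))
  rw [MeasureTheory.setAverage_eq, integral_pair (hintg x) (hintg w),
    ← intervalIntegral.integral_of_le hτ.le, ← intervalIntegral.integral_of_le hτ.le, hint] at hmem
  simpa [hτ.le] using hmem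

/-- A closed subspace containing the averages of all orbits contains the graph of the generator. -/
theorem IsC0Semigroup.mem_of_average_mem {S : ℝ≥0 → X →L[𝕜] X}
    (hS : IsC0Semigroup S) {Γ : Submodule 𝕜 (X × X)} (hΓ : IsClosed (Γ : Set (X × X)))
    [CompleteSpace X] {l : ℝ} (hl : 0 < l) {x w : X}
    (h : ∀ τ, 0 < τ → τ < l →
      (τ⁻¹ • ∫ s in (0 : ℝ)..τ, S s.toNNReal x, τ⁻¹ • (S τ.toNNReal x - x)) ∈ Γ)
    (hx : IsStrongDerivZeroAt S x w) : (x, w) ∈ Γ := by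
  have hcont : Continuous fun s : ℝ => S s.toNNReal x :=
    (hS.continuous x).comp continuous_real_toNNReal
  have h1 : Tendsto (fun τ : ℝ => τ⁻¹ • ∫ s in (0 : ℝ)..τ, S s.toNNReal x) (𝓝[>] 0) (𝓝 x) := by
    have := intervalIntegral.integral_hasDerivAt_right (hcont.intervalIntegrable 0 0)
      (hcont.stronglyMeasurableAtFilter _ _) hcont.continuousAt
    have := this.tendsto_slope_zero_right
    simpa [hS.map_zero] using this
  have h2 : Tendsto (fun τ : ℝ => τ⁻¹ • (S τ.toNNReal x - x)) (𝓝[>] 0) (𝓝 w) := by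
    have hlim : Tendsto Real.toNNReal (𝓝[>] 0) (𝓝[≠] 0) := by
      refine tendsto_nhdsWithin_iff.2
        ⟨(continuous_real_toNNReal.tendsto' 0 0 (by simp)).mono_left nhdsWithin_le_nhds, ?_⟩
      filter_upwards [self_mem_nhdsWithin] with τ hτ
      simpa using hτ
    refine (hx.comp hlim).congr' ?_
    filter_upwards [self_mem_nhdsWithin] with τ hτ
    have hτ' : (0 : ℝ) < τ := hτ
    rw [Function.comp_apply, hS.map_zero, one_apply_eq_self, Real.coe_toNNReal _ hτ'.le,
      ← RCLike.ofReal_inv, ← RCLike.real_smul_eq_coe_smul]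
  refine hΓ.mem_of_tendsto (h1.prodMk_nhds h2) ?_
  filter_upwards [Ioo_mem_nhdsGT hl] with τ hτ
  exact h τ hτ.1 hτ.2

end Generator

/-! ### Closures of graphs and the main theorem -/

/-- For a non-closable `Z`, `Z.closure` is `Z` itself by convention. Hence solutions for `Z.closure`
can be used before closability is known. -/
theorem LinearPMap.mem_closure_graph {𝕜 X : Type*} [RCLike 𝕜] [NormedAddCommGroup X]
    [NormedSpace 𝕜 X] (Z : X →ₗ.[𝕜] X) (x : Z.closure.domain) :
    ((x : X), Z.closure x) ∈ Z.graph.topologicalClosure := by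
  by_cases h : Z.IsClosable
  · rw [h.graph_closure_eq_closure_graph]
    exact Z.closure.mem_graph x
  · have hx := Z.closure.mem_graph x
    refine Submodule.le_topologicalClosure _ ?_
    rwa [congrArg LinearPMap.graph (LinearPMap.closure_def' h)] at hx

theorem LinearPMap.isClosable_and_closure_eq {𝕜 X : Type*} [RCLike 𝕜] [NormedAddCommGroup X]
    [NormedSpace 𝕜 X] {Z G : X →ₗ.[𝕜] X} (h : Z.graph.topologicalClosure = G.graph) :
    Z.IsClosable ∧ Z.closure = G := by
  have hZ : Z.IsClosable := ⟨G, h⟩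
  exact ⟨hZ, LinearPMap.eq_of_eq_graph (hZ.graph_closure_eq_closure_graph.symm.trans h)⟩

theorem mainTheorem2 {𝕜 X : Type*} [RCLike 𝕜] [NormedAddCommGroup X] [NormedSpace 𝕜 X]
    [NormedSpace ℝ X] [IsScalarTower ℝ 𝕜 X] [CompleteSpace X]
    (F : ℝ≥0 → X →L[𝕜] X) (hF : IsChernoffFunction F)
    (Z : X →ₗ.[𝕜] X) (hZ : Z ≤ strongDerivZero F)
    (A : Submodule 𝕜 X) (hAZ : A ≤ Z.domain) (hA : Dense (A : Set X))
    (l : ℝ) (hl : 0 < l)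
    (hsol : ∀ f₀ ∈ A, ∃ f : ℝ → X, IsLocalSolution Z.closure l f₀ f) :
    Z.IsClosable ∧
      ∃ S : ℝ≥0 → X →L[𝕜] X, IsGeneratorOf Z.closure S ∧
        ∀ (t : ℝ≥0) (f : X),
          Tendsto (fun n : ℕ => (F (t / n) ^ n) f) atTop (𝓝 (S t f)) := by
  obtain ⟨M, a, hM, hFM⟩ := hF
  have hst := hFM.isStable hM
  have h0 := hFM.map_zero
  have hd := hFM.dense_domain
  have hΓF : ∀ p ∈ Z.graph.topologicalClosure,
      p ∈ closure ((strongDerivZero F).graph : Set (X × X)) := fun p hp =>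
    closure_mono (LinearPMap.le_graph_of_le hZ) hp
  have hconv : ∀ (u : ℝ → X) (f₀ : X), IsLocalSolution Z.closure l f₀ u →
      ∀ t, 0 ≤ t → t < l → DiscreteTendsto F t f₀ (u t) := by
    rintro u f₀ ⟨rfl, hu⟩ t ht htl
    choose hmem hderiv using hu
    have hsub : Set.Icc 0 t ⊆ Set.Ico 0 l := fun s hs => ⟨hs.1, hs.2.trans_lt htl⟩
    classical
    refine hst.discreteTendsto_of_hasDerivWithinAt h0 hd ht
      -- The value `0` is never used, as `[0, t]` lies in `[0, l)`.
      (w := fun s => if hs : s ∈ Set.Ico 0 l then Z.closure ⟨u s, hmem s hs⟩ else 0) ?_ ?_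
    · intro s hs
      simp only [hsub hs, dif_pos]
      exact (hderiv s (hsub hs)).mono hsub
    · intro s hs
      simp only [hsub hs, dif_pos]
      exact hΓF _ (Z.mem_closure_graph ⟨u s, hmem s (hsub hs)⟩)
  obtain ⟨S, hS, hFS⟩ := hFM.exists_isC0Semigroup hM fun t f =>
    hst.exists_discreteTendsto h0 hd hl (fun s hs hsl f => by
      have hcl := hst.isClosed_setOf_discreteTendsto hs
      refine hcl.closure_subset_iff.2 (fun f₀ hf₀ => ?_) (hA f)
      obtain ⟨u, hu⟩ := hsol f₀ hf₀
      exact ⟨u s, hconv u f₀ hu s hs hsl⟩) t.coe_nonneg f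
  have hΓS : ∀ {x w : X}, (x, w) ∈ Z.graph.topologicalClosure → IsStrongDerivZeroAt S x w :=
    fun h => hst.isStrongDerivZeroAt_of_mem_closure h0 hd hS.map_zero hFS (hΓF _ h)
  have hΓ : IsClosed (Z.graph.topologicalClosure : Set (X × X)) :=
    Submodule.isClosed_topologicalClosure _
  have havg : ∀ f : X, ∀ τ, 0 < τ → τ < l →
      (τ⁻¹ • ∫ s in (0 : ℝ)..τ, S s.toNNReal f, τ⁻¹ • (S τ.toNNReal f - f)) ∈
        Z.graph.topologicalClosure := by
    intro f τ hτ hτl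
    refine (hS.isClosed_setOf_average_mem hΓ hτ.le).closure_subset_iff.2 (fun g hg => ?_) (hA f)
    obtain ⟨u, hu⟩ := hsol g hg
    have hgZ : (g, Z ⟨g, hAZ hg⟩) ∈ Z.graph.topologicalClosure :=
      Submodule.le_topologicalClosure _ (Z.mem_graph ⟨g, hAZ hg⟩)
    have hSu : ∀ s ∈ Set.Ico 0 l, S s.toNNReal g = u s := by
      intro s hs
      refine tendsto_nhds_unique (hFS s.toNNReal g) ?_
      rw [Real.coe_toNNReal _ hs.1]
      exact hconv u g hu s hs.1 hs.2
    -- Both sides are the value of `S'(0)` at `u s`. This makes the derivative of the solution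
    -- continuous, hence integrable.
    have hval : ∀ s ∈ Set.Ico 0 l, ∀ hs : u s ∈ Z.closure.domain,
        Z.closure ⟨u s, hs⟩ = S s.toNNReal (Z ⟨g, hAZ hg⟩) := by
      intro s hs hs'
      have h1 := hS.isStrongDerivZeroAt_apply (hΓS hgZ) s.toNNReal
      rw [hSu s hs] at h1
      exact (hΓS (Z.mem_closure_graph ⟨u s, hs'⟩)).unique h1
    refine hS.average_mem (w := Z ⟨g, hAZ hg⟩) hΓ hτ (fun s hs => ?_) (fun s hs => ?_)
    · have hs' : s ∈ Set.Ico 0 l := ⟨hs.1, hs.2.trans_lt hτl⟩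
      obtain ⟨hm, -⟩ := hu.2 s hs'
      rw [hSu s hs', ← hval s hs' hm]
      exact Z.mem_closure_graph ⟨u s, hm⟩
    · have hs' : s ∈ Set.Ico 0 l := ⟨hs.1.le, hs.2.trans hτl⟩
      obtain ⟨hm, hder⟩ := hu.2 s hs'
      rw [hval s hs' hm] at hder
      have hnhds : Set.Ico 0 l ∈ 𝓝 s := Ico_mem_nhds hs.1 hs'.2
      refine (hder.hasDerivAt hnhds).congr_of_eventuallyEq ?_
      filter_upwards [hnhds] with r hr using hSu r hr
  have hgraph : Z.graph.topologicalClosure = (strongDerivZero S).graph := by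
    refine le_antisymm ?_ ?_
    · rintro ⟨x, w⟩ h
      exact mem_graph_strongDerivZero_iff.2 (hΓS h)
    · rintro ⟨x, w⟩ h
      exact hS.mem_of_average_mem hΓ hl (havg x) (mem_graph_strongDerivZero_iff.1 h)
  obtain ⟨hclosable, hclosure⟩ := LinearPMap.isClosable_and_closure_eq hgraph
  exact ⟨hclosable, S, ⟨hS, hclosure⟩, fun t f => (hFS t f).tendsto_pow h0⟩
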